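/- **Notation.** Let $\mathbb{Z}\langle\mathbf a,\mathbf b\rangle$ be the ring of polynomials in two noncommuting variables and $R=\mathbb{Z}[y]\langle\mathbf a,\mathbf b\rangle$, with $y$ central. For a bounded finite graded poset $P$ with minimum $\widehat 0$, maximum $\widehat 1$ and rank $r$, the $\mathbf{ab}$-index is $\Psi_P=\sum_{\mathcal C} w_1^{\mathcal C}\cdots w_{r-1}^{\mathcal C}\in\mathbb{Z}\langle\mathbf a,\mathbf b\rangle$, summed over all chains $\mathcal C$ (including the empty one) in the open interval $(\widehat 0,\widehat 1)$, where $w_k^{\mathcal C}=\mathbf b$ if $\mathcal C$ contains an element of rank $k$ and $w_k^{\mathcal C}=\mathbf a-\mathbf b$ otherwise. Let $\omega:\mathbb{Z}\langle\mathbf a,\mathbf b\rangle\to R$ be the $\mathbb{Z}$-linear map which, in each monomial, replaces all occurrences of $\mathbf a\mathbf b$ by $(1+y)(\mathbf a\mathbf b+y\,\mathbf b\mathbf a)$, and all remaining occurrences of $\mathbf a$ by $\mathbf a+y\mathbf b$ and of $\mathbf b$ by $\mathbf b+y\mathbf a$. If $\widehat0\ne\widehat1$, the extended and the modified extended $\mathbf{ab}$-index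 of $P$ are $$\mathrm{ex}\Psi_P=\omega(\mathbf a\,\Psi_P),\qquad \widetilde{\mathrm{ex}}\Psi_P=(1+y)\,\omega(\Psi_P),$$ and both are defined to be $1$ if $\widehat 0=\widehat 1$. **Statement.** Let $\mathsf M$ be a matroid on a finite ground set $E$, with lattice of flats $\mathcal L(\mathsf M)$, whose least element $\widehat 0$ is the set of loops. Let $i\in E$ be an element that is neither a loop nor a coloop and that has no parallel elements, i.e. $\widehat 0\cup\{i\}$ is a flat of rank one. Put $$\mathscr S_i=\{F\in\mathcal L(\mathsf M): i\notin F,\ F\cup\{i\}\in\mathcal L(\mathsf M)\}.$$ Then $$\mathrm{ex}\Psi_{\mathcal L(\mathsf M)}=\mathrm{ex}\Psi_{\mathcal L(\mathsf M\setminus i)}+\sum_{F\in\mathscr S_i}\mathrm{ex}\Psi_{\mathcal L(\mathsf M|F)}\,(\mathbf a\mathbf b+y\,\mathbf b\mathbf a)\,\widetilde{\mathrm{ex}}\Psi_{\mathcal L(\mathsf M/(F\cup\{i\}))}$$ and $$\widetilde{\mathrm{ex}}\Psi_{\mathcal L(\mathsf M)}=\widetilde{\mathrm{ex}}\Psi_{\mathcal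 L(\mathsf M\setminus i)}+(\mathbf b+y\mathbf a)\,\widetilde{\mathrm{ex}}\Psi_{\mathcal L(\mathsf M/i)}+\sum_{F\in\mathscr S_i,\ F\neq\widehat 0}\widetilde{\mathrm{ex}}\Psi_{\mathcal L(\mathsf M|F)}\,(\mathbf a\mathbf b+y\,\mathbf b\mathbf a)\,\widetilde{\mathrm{ex}}\Psi_{\mathcal L(\mathsf M/(F\cup\{i\}))}.$$ -/

import Mathlib

open scoped Matroid

namespace ABIndex

/-- A rank function on (the intervals of) a poset: a weak rank function `ρ`, i.e. positive on proper
intervals and additive, for which every covering interval has rank one.  On a locally finite poset the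
last condition says that every interval `[s, t]` is graded and that `ρ s t` is the length of every
maximal chain of `[s, t]`. -/
structure RankFunction (P : Type*) [PartialOrder P] where
  /-- The rank `ρ s t` of the interval `[s, t]` (irrelevant unless `s ≤ t`). -/
  ρ : P → P → ℕ
  pos_of_lt : ∀ {s t : P}, s < t → 0 < ρ s t
  add : ∀ {s w t : P}, s ≤ w → w ≤ t → ρ s t = ρ s w + ρ w t
  eq_one_of_covBy : ∀ {s t : P}, s ⋖ t → ρ s t = 1

/-- The two letters. -/
inductive Letter : Type
  | a : Letter
  | b : Letter

/-- The ring `ℤ⟨a, b⟩` of noncommutative polynomials. -/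
abbrev ZAB : Type := FreeAlgebra ℤ Letter

/-- The ring `R = ℤ[y]⟨a, b⟩`, in which `y` is central. -/
abbrev ZyAB : Type := FreeAlgebra (Polynomial ℤ) Letter

/-- The generator `a`, over any coefficient ring. -/
def a {k : Type} [CommRing k] : FreeAlgebra k Letter := FreeAlgebra.ι k Letter.a

/-- The generator `b`, over any coefficient ring. -/
def b {k : Type} [CommRing k] : FreeAlgebra k Letter := FreeAlgebra.ι k Letter.b

/-- The central variable `y` of `ℤ[y]⟨a, b⟩`. -/
noncomputable def y : ZyAB := algebraMap (Polynomial ℤ) ZyAB Polynomial.X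

/-- The transformation `ω` on a word: every occurrence of `ab` becomes `(1 + y)(ab + y ba)`, and every
remaining `a` (resp. `b`) becomes `a + y b` (resp. `b + y a`). -/
noncomputable def omegaWord : List Letter → ZyAB
  | [] => 1
  | Letter.a :: Letter.b :: w => (1 + y) * (a * b + y * (b * a)) * omegaWord w
  | Letter.a :: w => (a + y * b) * omegaWord w
  | Letter.b :: w => (b + y * a) * omegaWord w

/-- The `ℤ`-linear (equivalently, additive) map `ω : ℤ⟨a, b⟩ → ℤ[y]⟨a, b⟩`, given by `omegaWord` on the
basis of words. -/
noncomputable def omega : ZAB →+ ZyAB :=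
  ((FreeAlgebra.basisFreeMonoid ℤ Letter).constr ℤ
    (fun w : FreeMonoid Letter => omegaWord w.toList)).toAddMonoidHom

section Poset

variable {P : Type*} [PartialOrder P]

open Classical in
/-- The weight `w₁ ⋯ w_{r-1}`, `r = ρ s t`, of a chain `C` in the interval `[s, t]`: the letter `w_k` is
`b` if `C` has an element of rank `k` in `[s, t]`, and `a - b` otherwise. -/
noncomputable def weight (r : RankFunction P) (s t : P) (C : Finset P) : ZAB :=
  ((List.range (r.ρ s t - 1)).map
    (fun k => if ∃ c ∈ C, r.ρ s c = k + 1 then b else a - b)).prod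

open Classical in
/-- The `ab`-index `Ψ_{st}`: the sum of the weights of all chains in the open interval `(s, t)`. -/
noncomputable def abIndex [LocallyFiniteOrder P] (r : RankFunction P) (s t : P) : ZAB :=
  ∑ C ∈ (Finset.Ioo s t).powerset.filter (fun C : Finset P => IsChain (· ≤ ·) (C : Set P)),
    weight r s t C

open Classical in
/-- The extended `ab`-index: `ω(a Ψ_{st})` for `s < t`, and `1` for `s = t`. -/
noncomputable def extAbIndex [LocallyFiniteOrder P] (r : RankFunction P) (s t : P) : ZyAB :=
  if s = t then 1 else omega (a * abIndex r s t)

open Classical in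
/-- The modified extended `ab`-index: `(1 + y) ω(Ψ_{st})` for `s < t`, and `1` for `s = t`. -/
noncomputable def modExtAbIndex [LocallyFiniteOrder P] (r : RankFunction P) (s t : P) : ZyAB :=
  if s = t then 1 else (1 + y) * omega (abIndex r s t)

end Poset

section Flats

variable {α : Type*}

/-- The lattice of flats of a matroid, ordered by inclusion. -/
abbrev Flats (M : Matroid α) : Type _ := {F : Set α // M.IsFlat F}

/-- The least flat is the closure of the empty set (the set of loops), the greatest is the ground set. -/
instance (M : Matroid α) : BoundedOrder (Flats M) where
  top := ⟨M.E, M.ground_isFlat⟩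
  le_top F := F.2.subset_ground
  bot := ⟨M.loops, M.isFlat_closure ∅⟩
  bot_le F := F.2.loops_subset

instance (M : Matroid α) [M.Finite] : Finite (Flats M) :=
  Set.Finite.to_subtype
    ((M.ground_finite.finite_subsets).subset fun _ hF => Matroid.IsFlat.subset_ground hF)

noncomputable instance (M : Matroid α) [M.Finite] : Fintype (Flats M) := Fintype.ofFinite _

noncomputable instance (M : Matroid α) [M.Finite] : LocallyFiniteOrder (Flats M) :=
  LocallyFiniteOrder.ofFiniteIcc fun _ _ => Set.toFinite _

instance (M : Matroid α) [M.Finite] (F : Flats M) : (M ↾ (F : Set α)).Finite :=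
  Matroid.restrict_finite (M.ground_finite.subset F.2.subset_ground)

theorem eRk_ne_top (M : Matroid α) [M.Finite] (X : Set α) : M.eRk X ≠ ⊤ :=
  ((M.eRk_le_eRank X).trans_lt (M.eRank_lt_top_iff.2 inferInstance)).ne

theorem rank_mono (M : Matroid α) [M.Finite] {X Y : Set α} (h : X ⊆ Y) :
    (M.eRk X).toNat ≤ (M.eRk Y).toNat :=
  ENat.toNat_le_toNat (M.eRk_mono h) (eRk_ne_top M Y)

theorem rank_insert (M : Matroid α) [M.Finite] {F : Set α} (hF : M.IsFlat F) {e : α}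
    (he : e ∈ M.E) (heF : e ∉ F) : (M.eRk (insert e F)).toNat = (M.eRk F).toNat + 1 := by
  rw [M.eRk_insert_eq_add_one ⟨he, by rwa [hF.closure]⟩,
    ENat.toNat_add (eRk_ne_top M F) (by simp)]
  rfl

/-- The rank function of the lattice of flats: `ρ F G = rk G - rk F`. -/
noncomputable def flatRank (M : Matroid α) [M.Finite] : RankFunction (Flats M) where
  ρ F G := (M.eRk G).toNat - (M.eRk F).toNat
  pos_of_lt {F G} h := by
    obtain ⟨e, heG, heF⟩ := Set.exists_of_ssubset (show (F : Set α) ⊂ G from h)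
    have h1 := rank_insert M F.2 (G.2.subset_ground heG) heF
    have h2 := rank_mono M (Set.insert_subset heG h.le)
    omega
  add {F W G} h1 h2 := by
    have := rank_mono M (show (F : Set α) ⊆ W from h1)
    have := rank_mono M (show (W : Set α) ⊆ G from h2)
    omega
  eq_one_of_covBy {F G} h := by
    obtain ⟨e, heG, heF⟩ := Set.exists_of_ssubset (show (F : Set α) ⊂ G from h.lt)
    have heE := G.2.subset_ground heG
    have hsub : insert e (F : Set α) ⊆ G := Set.insert_subset heG h.le
    have hins : insert e (F : Set α) ⊆ M.closure (insert e F) :=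
      M.subset_closure _ (hsub.trans G.2.subset_ground)
    have hle : M.closure (insert e (F : Set α)) ⊆ G := by
      have := M.closure_subset_closure hsub
      rwa [G.2.closure] at this
    have hcl : M.closure (insert e (F : Set α)) = G := by
      let W : Flats M := ⟨M.closure (insert e F), M.isFlat_closure _⟩
      have hFW : F < W := lt_of_le_of_ne ((Set.subset_insert e _).trans hins)
        (fun hh => heF (by rw [hh]; exact hins (Set.mem_insert e _)))
      have hWG : W = G := (show W ≤ G from hle).eq_of_not_lt (h.2 hFW)
      exact congrArg Subtype.val hWG
    have h1 := rank_insert M F.2 heE heF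
    rw [← M.eRk_closure_eq, hcl] at h1
    omega

/-- The extended `ab`-index of the lattice of flats of `M`. -/
noncomputable def matroidExt (M : Matroid α) [M.Finite] : ZyAB :=
  extAbIndex (flatRank M) ⊥ ⊤

/-- The modified extended `ab`-index of the lattice of flats of `M`. -/
noncomputable def matroidModExt (M : Matroid α) [M.Finite] : ZyAB :=
  modExtAbIndex (flatRank M) ⊥ ⊤

open Classical in
/-- The set of flats `F` of `M` with `i ∉ F` such that `F ∪ {i}` is again a flat of `M`. -/
noncomputable def flatsS (M : Matroid α) [M.Finite] (i : α) : Finset (Flats M) :=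
  {F | i ∉ (F : Set α) ∧ M.IsFlat (insert i (F : Set α))}

open Classical in
/-- The set `flatsS M i` without the least flat. -/
noncomputable def flatsS' (M : Matroid α) [M.Finite] (i : α) : Finset (Flats M) :=
  (flatsS M i).erase ⊥

end Flats

end ABIndex

/-!
The formula follows from an identity between ordinary `ab`-indices, `abIndex_deletion`:

  `Ψ(M) = Ψ(M ＼ i) + b Ψ(M ／ i) + ∑ Ψ(M ↾ F) a b Ψ(M ／ (F ∪ i))`,

the sum being over the flats `F ≠ 0̂` for which `i ∉ F` and `F ∪ i` is a flat. Both extended identities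
are images of it under `ω`, since `ω` is multiplicative across an explicit `ab`
(`omega_mul_ab_mul`): the factor `1 + y` which `ω` puts on that `ab` is the one in the definition of the
modified index of `M ／ (F ∪ i)`. For the first identity one multiplies by `a` on the left beforehand, and
the term of `M ／ i` becomes the summand of `F = 0̂`.

To prove the identity, let `D` be the set of the flats `F ∪ i` above. Taking closures identifies the flats
of `M ＼ i` with the flats of `M` outside `D`, with the same ranks (`map_deleteFlats_Ioo`,
`flatRank_deleteFlats`), so the chains avoiding `D` contribute `Ψ(M ＼ i)`. The other chains are sorted by
their least element `F ∪ i` in `D` (`chainSum_eq_add_sum_first`). The part above it is any chain of an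
interval isomorphic to the lattice of flats of `M ／ (F ∪ i)`. The part below it is any chain of the
half-open interval from `0̂` to `F`, because a flat outside `D` and below `F ∪ i` lies below `F`
(`Ioo_sdiff_flatsT_filter`). Whether or not `F` itself belongs to the chain decides between the letters
`b` and `a - b` in the rank of `F`, and the two add up to `a` (`chainSum_Ioc`).
-/

namespace ABIndex

/-! ### Weighted sums over chains -/

section Chains

variable {P Q : Type*} [PartialOrder P] [PartialOrder Q]

theorem RankFunction.ρ_self (r : RankFunction P) (s : P) : r.ρ s s = 0 := by
  have := r.add (le_refl s) (le_refl s)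
  omega

open Classical in
/-- The sum of the weights, in the interval `[s, t]`, of the chains contained in a finite set `A`. -/
noncomputable def chainSum (r : RankFunction P) (s t : P) (A : Finset P) : ZAB :=
  ∑ C ∈ A.powerset.filter (fun C : Finset P => IsChain (· ≤ ·) (C : Set P)), weight r s t C

theorem abIndex_eq_chainSum [LocallyFiniteOrder P] (r : RankFunction P) (s t : P) :
    abIndex r s t = chainSum r s t (Finset.Ioo s t) := rfl

theorem chainSum_empty {r : RankFunction P} {s t : P} (h : r.ρ s t = 1) :
    chainSum r s t ∅ = 1 := by
  classical
  have : (Finset.powerset (∅ : Finset P)).filter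
      (fun C : Finset P => IsChain (· ≤ ·) (C : Set P)) = {∅} := by
    ext C
    simp only [Finset.mem_filter, Finset.mem_powerset, Finset.subset_empty, Finset.mem_singleton,
      and_iff_left_iff_imp]
    rintro rfl
    simp
  rw [chainSum, this]
  simp [weight, h]

/-- Chain sums transfer along order embeddings that preserve the ranks measured from `s`. -/
theorem chainSum_map {r : RankFunction P} {r' : RankFunction Q} (φ : P ↪o Q) {s t : P} {s' t' : Q}
    {A : Finset P} (h : r.ρ s t = r'.ρ s' t') (hA : ∀ c ∈ A, r.ρ s c = r'.ρ s' (φ c)) :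
    chainSum r s t A = chainSum r' s' t' (A.map φ.toEmbedding) := by
  classical
  unfold chainSum
  refine Finset.sum_bij (fun C _ => C.map φ.toEmbedding) ?_ ?_ ?_ ?_
  · intro C hC
    rw [Finset.mem_filter, Finset.mem_powerset] at hC ⊢
    refine ⟨Finset.map_subset_map.2 hC.1, ?_⟩
    rw [Finset.coe_map]
    rintro _ ⟨x, hx, rfl⟩ _ ⟨y, hy, rfl⟩ hne
    have := hC.2 hx hy (fun h => hne (by rw [h]))
    simpa using this
  · intro C _ C' _ hCC
    exact Finset.map_injective _ hCC
  · intro C' hC'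
    rw [Finset.mem_filter, Finset.mem_powerset, Finset.subset_map_iff] at hC'
    obtain ⟨⟨C, hCA, rfl⟩, hch⟩ := hC'
    refine ⟨C, ?_, rfl⟩
    rw [Finset.mem_filter, Finset.mem_powerset]
    refine ⟨hCA, fun x hx y hy hne => ?_⟩
    have := hch (Finset.mem_coe.2 (Finset.mem_map_of_mem _ hx))
      (Finset.mem_coe.2 (Finset.mem_map_of_mem _ hy)) (fun h => hne (φ.injective h))
    simpa using this
  · intro C hC
    rw [Finset.mem_filter, Finset.mem_powerset] at hC
    unfold weight
    rw [h]
    congr 1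
    refine List.map_congr_left fun k _ => ?_
    congr 1
    refine propext ⟨?_, ?_⟩
    · rintro ⟨c, hc, hk⟩
      exact ⟨φ c, Finset.mem_map_of_mem _ hc, by rw [← hA c (hC.1 hc), hk]⟩
    · rintro ⟨_, hc', hk⟩
      obtain ⟨c, hc, rfl⟩ := Finset.mem_map.1 hc'
      exact ⟨c, hc, by rw [hA c (hC.1 hc)]; exact hk⟩

/-- Two rank functions agree along an order embedding that preserves covering relations, since a rank
function is determined by its values on covers. -/
theorem ρ_eq_of_covBy_map [LocallyFiniteOrder P] {r : RankFunction P} {r' : RankFunction Q}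
    (φ : P ↪o Q) (hφ : ∀ {x z : P}, x ⋖ z → φ x ⋖ φ z) {s t : P} (hst : s ≤ t) :
    r.ρ s t = r'.ρ (φ s) (φ t) := by
  induction hn : r.ρ s t using Nat.strong_induction_on generalizing s with
  | _ n ih =>
    rcases hst.eq_or_lt with rfl | hlt
    · rw [← hn, RankFunction.ρ_self, RankFunction.ρ_self]
    · obtain ⟨w, hw, hwt⟩ := exists_covBy_le_of_lt hlt
      have h1 := r.add hw.le hwt
      have h2 := r'.add (φ.monotone hw.le) (φ.monotone hwt)
      rw [r.eq_one_of_covBy hw] at h1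
      rw [r'.eq_one_of_covBy (hφ hw)] at h2
      have := ih (r.ρ w t) (by omega) hwt rfl
      omega

/-- The weight of a chain through `x` factors at `x`. -/
theorem weight_split {r : RankFunction P} {s x t : P} {C : Finset P} (hsx : s < x) (hxt : x < t)
    (hx : x ∈ C) {C₁ C₂ : Finset P} (h₁ : ∀ c, c ∈ C₁ ↔ c ∈ C ∧ c < x)
    (h₂ : ∀ c, c ∈ C₂ ↔ c ∈ C ∧ x < c) (hC : IsChain (· ≤ ·) (C : Set P))
    (hs : ∀ c ∈ C, s < c) :
    weight r s t C = weight r s x C₁ * b * weight r x t C₂ := by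
  classical
  have p1 := r.pos_of_lt hsx
  have p2 := r.pos_of_lt hxt
  have hst := r.add hsx.le hxt.le
  -- The letters before rank `ρ s x`, the letter at that rank, and the letters after it.
  have hlen : r.ρ s t - 1 = (r.ρ s x - 1) + (1 + (r.ρ x t - 1)) := by omega
  have tri : ∀ c ∈ C, c < x ∨ c = x ∨ x < c := fun c hc => by
    by_cases hcx : c = x
    · exact Or.inr (Or.inl hcx)
    · rcases hC hc hx hcx with h | h
      · exact Or.inl (lt_of_le_of_ne h hcx)
      · exact Or.inr (Or.inr (lt_of_le_of_ne h (Ne.symm hcx)))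
  unfold weight
  rw [hlen, List.range_add, List.map_append, List.prod_append, List.range_add, List.map_append,
    List.map_append, List.prod_append, ← mul_assoc]
  congr 1
  · congr 1
    · congr 1
      refine List.map_congr_left fun k hk => ?_
      rw [List.mem_range] at hk
      congr 1
      refine propext ⟨?_, ?_⟩
      · rintro ⟨c, hc, hck⟩
        refine ⟨c, (h₁ c).2 ⟨hc, ?_⟩, hck⟩
        rcases tri c hc with h | rfl | h
        · exact h
        · omega
        · have := r.add hsx.le h.le
          omega
      · rintro ⟨c, hc, hck⟩
        exact ⟨c, ((h₁ c).1 hc).1, hck⟩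
    · have : ∃ c ∈ C, r.ρ s c = r.ρ s x - 1 + 1 := ⟨x, hx, by omega⟩
      simp [this]
  · rw [List.map_map, List.map_map]
    congr 1
    refine List.map_congr_left fun k hk => ?_
    simp only [Function.comp_apply]
    congr 1
    refine propext ⟨?_, ?_⟩
    · rintro ⟨c, hc, hck⟩
      have hxc : x < c := by
        rcases tri c hc with h | rfl | h
        · have := r.add (hs c hc).le h.le
          omega
        · omega
        · exact h
      have := r.add hsx.le hxc.le
      exact ⟨c, (h₂ c).2 ⟨hc, hxc⟩, by omega⟩
    · rintro ⟨c, hc, hck⟩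
      obtain ⟨hcC, hxc⟩ := (h₂ c).1 hc
      have := r.add hsx.le hxc.le
      exact ⟨c, hcC, by omega⟩

open Classical in
/-- The chains of `L ∪ {x} ∪ U` through `x`, where `L` lies below `x` and `U` above it, are the pairs of
a chain of `L` and a chain of `U`. -/
theorem sum_weight_through [DecidableEq P] {r : RankFunction P} {s x t : P} {L U : Finset P} (hsx : s < x)
    (hxt : x < t) (hL : ∀ c ∈ L, s < c ∧ c < x) (hU : ∀ c ∈ U, x < c) :
    ∑ C ∈ (insert x (L ∪ U)).powerset.filter
        (fun C : Finset P => IsChain (· ≤ ·) (C : Set P) ∧ x ∈ C), weight r s t C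
      = chainSum r s x L * b * chainSum r x t U := by
  unfold chainSum
  rw [Finset.sum_mul, Finset.sum_mul_sum, ← Finset.sum_product']
  refine Finset.sum_nbij' (fun C => (C.filter (· < x), C.filter (x < ·)))
    (fun p => insert x (p.1 ∪ p.2)) ?_ ?_ ?_ ?_ ?_
  · intro C hC
    simp only [Finset.mem_filter, Finset.mem_powerset] at hC
    obtain ⟨hsub, hch, hx⟩ := hC
    simp only [Finset.mem_product, Finset.mem_filter, Finset.mem_powerset]
    refine ⟨⟨fun c hc => ?_, hch.mono fun c hc => ?_⟩, fun c hc => ?_, hch.mono fun c hc => ?_⟩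
    · rw [Finset.mem_filter] at hc
      have := hsub hc.1
      simp only [Finset.mem_insert, Finset.mem_union] at this
      rcases this with rfl | h | h
      · exact absurd hc.2 (lt_irrefl _)
      · exact h
      · exact absurd (hU c h) hc.2.not_gt
    · exact (Finset.mem_filter.1 hc).1
    · rw [Finset.mem_filter] at hc
      have := hsub hc.1
      simp only [Finset.mem_insert, Finset.mem_union] at this
      rcases this with rfl | h | h
      · exact absurd hc.2 (lt_irrefl _)
      · exact absurd (hL c h).2 hc.2.not_gt
      · exact h
    · exact (Finset.mem_filter.1 hc).1
  · rintro ⟨C₁, C₂⟩ hp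
    simp only [Finset.mem_product, Finset.mem_filter, Finset.mem_powerset] at hp
    obtain ⟨⟨h1, hc1⟩, h2, hc2⟩ := hp
    simp only [Finset.mem_filter, Finset.mem_powerset]
    refine ⟨Finset.insert_subset_insert _ (Finset.union_subset_union h1 h2), ?_,
      Finset.mem_insert_self _ _⟩
    intro c hc d hd hne
    simp only [Finset.coe_insert, Finset.coe_union, Set.mem_insert_iff, Set.mem_union,
      Finset.mem_coe] at hc hd
    have l1 : ∀ c ∈ C₁, c < x := fun c hc => (hL c (h1 hc)).2
    have l2 : ∀ c ∈ C₂, x < c := fun c hc => hU c (h2 hc)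
    rcases hc with rfl | hc | hc <;> rcases hd with rfl | hd | hd
    · exact absurd rfl hne
    · exact Or.inr (l1 _ hd).le
    · exact Or.inl (l2 _ hd).le
    · exact Or.inl (l1 _ hc).le
    · exact hc1 hc hd hne
    · exact Or.inl ((l1 _ hc).trans (l2 _ hd)).le
    · exact Or.inr (l2 _ hc).le
    · exact Or.inr ((l1 _ hd).trans (l2 _ hc)).le
    · exact hc2 hc hd hne
  · intro C hC
    simp only [Finset.mem_filter, Finset.mem_powerset] at hC
    obtain ⟨hsub, hch, hx⟩ := hC
    ext c
    simp only [Finset.mem_insert, Finset.mem_union, Finset.mem_filter]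
    refine ⟨?_, fun hc => ?_⟩
    · rintro (rfl | h | h)
      exacts [hx, h.1, h.1]
    · by_cases hcx : c = x
      · exact Or.inl hcx
      · rcases hch hc hx hcx with h | h
        · exact Or.inr (Or.inl ⟨hc, lt_of_le_of_ne h hcx⟩)
        · exact Or.inr (Or.inr ⟨hc, lt_of_le_of_ne h (Ne.symm hcx)⟩)
  · rintro ⟨C₁, C₂⟩ hp
    simp only [Finset.mem_product, Finset.mem_filter, Finset.mem_powerset] at hp
    obtain ⟨⟨h1, hc1⟩, h2, hc2⟩ := hp
    have l1 : ∀ c ∈ C₁, c < x := fun c hc => (hL c (h1 hc)).2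
    have l2 : ∀ c ∈ C₂, x < c := fun c hc => hU c (h2 hc)
    refine Prod.ext ?_ ?_
    · ext c
      simp only [Finset.mem_insert, Finset.mem_union, Finset.mem_filter]
      refine ⟨?_, fun h => ⟨Or.inr (Or.inl h), l1 c h⟩⟩
      rintro ⟨rfl | h | h, hlt⟩
      exacts [absurd hlt (lt_irrefl _), h, absurd (l2 c h) hlt.not_gt]
    · ext c
      simp only [Finset.mem_insert, Finset.mem_union, Finset.mem_filter]
      refine ⟨?_, fun h => ⟨Or.inr (Or.inr h), l2 c h⟩⟩
      rintro ⟨rfl | h | h, hlt⟩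
      exacts [absurd hlt (lt_irrefl _), absurd (l1 c h) hlt.not_gt, h]
  · intro C hC
    simp only [Finset.mem_filter, Finset.mem_powerset] at hC
    obtain ⟨hsub, hch, hx⟩ := hC
    refine weight_split hsx hxt hx (fun c => Finset.mem_filter) (fun c => Finset.mem_filter) hch ?_
    intro c hc
    have := hsub hc
    simp only [Finset.mem_insert, Finset.mem_union] at this
    rcases this with rfl | h | h
    exacts [hsx, (hL c h).1, hsx.trans (hU c h)]

/-- The chains of `A` that meet `D` are classified by their least element in `D`. -/
theorem chainSum_eq_add_sum_first [DecidableEq P] [DecidableLT P] {r : RankFunction P} {s t : P} {A D : Finset P}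
    (hA : ∀ c ∈ A, s < c ∧ c < t) (hD : D ⊆ A) :
    chainSum r s t A = chainSum r s t (A \ D)
      + ∑ d ∈ D, chainSum r s d ((A \ D).filter (· < d)) * b
          * chainSum r d t (A.filter (d < ·)) := by
  classical
  set T := A.powerset.filter (fun C : Finset P => IsChain (· ≤ ·) (C : Set P)) with hT
  have key : ∀ d ∈ D, chainSum r s d ((A \ D).filter (· < d)) * b
      * chainSum r d t (A.filter (d < ·))
      = ∑ C ∈ T.filter (fun C => d ∈ C ∧ ∀ c ∈ C, c ∈ D → d ≤ c), weight r s t C := by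
    intro d hd
    rw [← sum_weight_through (hA d (hD hd)).1 (hA d (hD hd)).2
      (fun c hc => ?_) (fun c hc => (Finset.mem_filter.1 hc).2)]
    · refine Finset.sum_congr ?_ fun _ _ => rfl
      ext C
      simp only [hT, Finset.mem_filter, Finset.mem_powerset]
      constructor
      · rintro ⟨hsub, hch, hdC⟩
        refine ⟨⟨fun c hc => ?_, hch⟩, hdC, fun c hc hcD => ?_⟩
        · have := hsub hc
          simp only [Finset.mem_insert, Finset.mem_union, Finset.mem_filter,
            Finset.mem_sdiff] at this
          rcases this with rfl | h | h
          exacts [hD hd, h.1.1, h.1]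
        · have := hsub hc
          simp only [Finset.mem_insert, Finset.mem_union, Finset.mem_filter,
            Finset.mem_sdiff] at this
          rcases this with rfl | h | h
          exacts [le_rfl, absurd hcD h.1.2, h.2.le]
      · rintro ⟨⟨hsub, hch⟩, hdC, hmin⟩
        refine ⟨fun c hc => ?_, hch, hdC⟩
        simp only [Finset.mem_insert, Finset.mem_union, Finset.mem_filter, Finset.mem_sdiff]
        by_cases hcd : c = d
        · exact Or.inl hcd
        · rcases hch hc hdC hcd with h | h
          · have hlt := lt_of_le_of_ne h hcd
            exact Or.inr (Or.inl ⟨⟨hsub hc, fun hcD => (hmin c hc hcD).not_gt hlt⟩, hlt⟩)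
          · exact Or.inr (Or.inr ⟨hsub hc, lt_of_le_of_ne h (Ne.symm hcd)⟩)
    · simp only [Finset.mem_filter, Finset.mem_sdiff] at hc
      exact ⟨(hA c hc.1.1).1, hc.2⟩
  rw [Finset.sum_congr rfl key, ← Finset.sum_biUnion]
  · unfold chainSum
    rw [← hT, ← Finset.sum_filter_add_sum_filter_not T (fun C => Disjoint C D)]
    congr 1
    · refine Finset.sum_congr ?_ fun _ _ => rfl
      ext C
      simp only [hT, Finset.mem_filter, Finset.mem_powerset, Finset.subset_sdiff]
      tauto
    · refine Finset.sum_congr ?_ fun _ _ => rfl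
      ext C
      simp only [Finset.mem_biUnion, Finset.mem_filter]
      constructor
      · rintro ⟨hC, hnd⟩
        obtain ⟨z, hzC, hzD⟩ := Finset.not_disjoint_iff.1 hnd
        obtain ⟨d, hd⟩ := (C ∩ D).exists_minimal ⟨z, Finset.mem_inter.2 ⟨hzC, hzD⟩⟩
        have hdm := Finset.mem_inter.1 hd.prop
        refine ⟨d, hdm.2, hC, hdm.1, fun c hc hcD => ?_⟩
        have hch := (Finset.mem_filter.1 hC).2
        rcases hch.total hc hdm.1 with h | h
        · exact hd.le_of_le (Finset.mem_inter.2 ⟨hc, hcD⟩) h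
        · exact h
      · rintro ⟨d, hdD, hC, hdC, -⟩
        exact ⟨hC, Finset.not_disjoint_iff.2 ⟨d, hdC, hdD⟩⟩
  · intro d hd e he hne
    refine Finset.disjoint_left.2 fun C h1 h2 => hne ?_
    rw [Finset.mem_filter] at h1 h2
    exact le_antisymm (h1.2.2 e h2.2.1 he) (h2.2.2 d h1.2.1 hd)

/-- The chains of `(s, x]`, weighted in an interval `[s, t]` of which `x` is a coatom: the last letter is
`a - b` for the chains without `x` and `b` for those with `x`, hence `a` in total. -/
theorem chainSum_Ioc [LocallyFiniteOrder P] {r : RankFunction P} {s x t : P} (hsx : s < x)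
    (hxt : x < t) (h1 : r.ρ x t = 1) :
    chainSum r s t (Finset.Ioc s x) = abIndex r s x * a := by
  classical
  have hst := r.add hsx.le hxt.le
  have p1 := r.pos_of_lt hsx
  have e1 : Finset.Ioc s x \ {x} = Finset.Ioo s x := by
    ext c
    simp only [Finset.mem_sdiff, Finset.mem_Ioc, Finset.mem_singleton, Finset.mem_Ioo,
      lt_iff_le_and_ne (a := c)]
    tauto
  have e2 : (Finset.Ioo s x).filter (· < x) = Finset.Ioo s x :=
    Finset.filter_true_of_mem fun c hc => (Finset.mem_Ioo.1 hc).2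
  have e3 : (Finset.Ioc s x).filter (x < ·) = ∅ :=
    Finset.filter_false_of_mem fun c hc => (Finset.mem_Ioc.1 hc).2.not_gt
  -- No element of `(s, x)` has the rank of `x`, so the last letter of each word is `a - b`.
  have e4 : chainSum r s t (Finset.Ioo s x) = abIndex r s x * (a - b) := by
    rw [abIndex_eq_chainSum]
    unfold chainSum
    rw [Finset.sum_mul]
    refine Finset.sum_congr rfl fun C hC => ?_
    rw [Finset.mem_filter, Finset.mem_powerset] at hC
    unfold weight
    rw [show r.ρ s t - 1 = (r.ρ s x - 1) + 1 by omega, List.range_succ, List.map_append,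
      List.prod_append]
    congr 1
    have : ¬ ∃ c ∈ C, r.ρ s c = r.ρ s x - 1 + 1 := by
      rintro ⟨c, hc, hcx⟩
      have hc' := Finset.mem_Ioo.1 (hC.1 hc)
      have := r.add hc'.1.le hc'.2.le
      have := r.pos_of_lt hc'.2
      omega
    simp [this]
  rw [chainSum_eq_add_sum_first (D := {x})
    (fun c hc => ⟨(Finset.mem_Ioc.1 hc).1, (Finset.mem_Ioc.1 hc).2.trans_lt hxt⟩)
    (by simpa using hsx), Finset.sum_singleton, e1, e2, e3, chainSum_empty h1, e4,
    ← abIndex_eq_chainSum, mul_one, ← mul_add, sub_add_cancel]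

variable [LocallyFiniteOrder P] [LocallyFiniteOrder Q]

/-- The `ab`-index is invariant under rank-preserving embeddings onto intervals. -/
theorem abIndex_map {r : RankFunction P} {r' : RankFunction Q} (φ : P ↪o Q) {s t : P}
    (hst : s ≤ t) (hρ : ∀ z, s ≤ z → r.ρ s z = r'.ρ (φ s) (φ z))
    (himg : ∀ q, φ s < q → q < φ t → ∃ p, φ p = q) :
    abIndex r s t = abIndex r' (φ s) (φ t) := by
  rw [abIndex_eq_chainSum, abIndex_eq_chainSum,
    chainSum_map φ (hρ t hst) (fun c hc => hρ c (Finset.mem_Ioo.1 hc).1.le)]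
  congr 1
  ext q
  simp only [Finset.mem_map, Finset.mem_Ioo, RelEmbedding.coe_toEmbedding]
  constructor
  · rintro ⟨p, hp, rfl⟩
    simpa using hp
  · rintro ⟨h1, h2⟩
    obtain ⟨p, rfl⟩ := himg q h1 h2
    exact ⟨p, by simpa using And.intro h1 h2, rfl⟩

end Chains

/-! ### The transformation `ω` -/

section Omega

theorem omega_word (w : FreeMonoid Letter) :
    omega (FreeAlgebra.basisFreeMonoid ℤ Letter w) = omegaWord w.toList := by
  change (FreeAlgebra.basisFreeMonoid ℤ Letter).constr ℤ _ _ = _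
  rw [Module.Basis.constr_basis]

theorem basisFreeMonoid_mul (u v : FreeMonoid Letter) :
    FreeAlgebra.basisFreeMonoid ℤ Letter (u * v)
      = FreeAlgebra.basisFreeMonoid ℤ Letter u * FreeAlgebra.basisFreeMonoid ℤ Letter v := by
  change FreeAlgebra.equivMonoidAlgebraFreeMonoid.symm (MonoidAlgebra.single (u * v) 1)
    = FreeAlgebra.equivMonoidAlgebraFreeMonoid.symm (MonoidAlgebra.single u 1)
      * FreeAlgebra.equivMonoidAlgebraFreeMonoid.symm (MonoidAlgebra.single v 1)
  rw [← map_mul, MonoidAlgebra.single_mul_single, mul_one]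

theorem basisFreeMonoid_of (l : Letter) :
    FreeAlgebra.basisFreeMonoid ℤ Letter (FreeMonoid.of l) = FreeAlgebra.ι ℤ l := by
  change FreeAlgebra.equivMonoidAlgebraFreeMonoid.symm (MonoidAlgebra.single _ 1) = _
  rw [AlgEquiv.symm_apply_eq]
  simp [FreeAlgebra.equivMonoidAlgebraFreeMonoid]

/-- Additive functions of noncommutative polynomials that agree on words are equal. -/
theorem eq_of_additive_of_word {f g : ZAB → ZyAB} (hf : ∀ u v, f (u + v) = f u + f v)
    (hg : ∀ u v, g (u + v) = g u + g v)
    (h : ∀ w, f (FreeAlgebra.basisFreeMonoid ℤ Letter w)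
      = g (FreeAlgebra.basisFreeMonoid ℤ Letter w)) (u : ZAB) : f u = g u := by
  have : (AddMonoidHom.mk' f hf).toIntLinearMap = (AddMonoidHom.mk' g hg).toIntLinearMap :=
    (FreeAlgebra.basisFreeMonoid ℤ Letter).ext h
  exact DFunLike.congr_fun this u

theorem omegaWord_append_ab (u v : List Letter) :
    omegaWord (u ++ Letter.a :: Letter.b :: v)
      = omegaWord u * ((1 + y) * (a * b + y * (b * a))) * omegaWord v := by
  induction u using omegaWord.induct with
  | case1 => simp [omegaWord]
  | case2 w ih => simp only [List.cons_append, omegaWord, ih, mul_assoc]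
  | case3 w hw ih =>
    have e1 : omegaWord (Letter.a :: w) = (a + y * b) * omegaWord w := by
      rw [omegaWord]
      exact hw
    have e2 : omegaWord (Letter.a :: (w ++ Letter.a :: Letter.b :: v))
        = (a + y * b) * omegaWord (w ++ Letter.a :: Letter.b :: v) := by
      rw [omegaWord]
      -- Appending a word that begins with `a` does not create an `ab` across the boundary.
      rintro w' h
      cases w with
      | nil => simp at h
      | cons l w =>
        simp only [List.cons_append, List.cons.injEq] at h
        exact hw w (by rw [h.1])
    rw [List.cons_append, e1, e2, ih]
    simp only [mul_assoc]
  | case4 w ih => simp only [List.cons_append, omegaWord, ih, mul_assoc]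

/-- `ω` is multiplicative across an explicit factor `ab`, because no occurrence of `ab` straddles its
ends. -/
theorem omega_mul_ab_mul (u v : ZAB) :
    omega (u * (a * b) * v) = omega u * ((1 + y) * (a * b + y * (b * a))) * omega v := by
  refine eq_of_additive_of_word (f := fun u => omega (u * (a * b) * v))
    (g := fun u => omega u * ((1 + y) * (a * b + y * (b * a))) * omega v)
    (fun u₁ u₂ => ?_) (fun u₁ u₂ => ?_) (fun u => ?_) u
  · rw [add_mul, add_mul, map_add]
  · rw [map_add, add_mul (omega u₁), add_mul (omega u₁ * _)]
  refine eq_of_additive_of_word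
    (f := fun v => omega (FreeAlgebra.basisFreeMonoid ℤ Letter u * (a * b) * v))
    (g := fun v => omega (FreeAlgebra.basisFreeMonoid ℤ Letter u)
      * ((1 + y) * (a * b + y * (b * a))) * omega v)
    (fun v₁ v₂ => ?_) (fun v₁ v₂ => ?_) (fun v => ?_) v
  · rw [mul_add, map_add]
  · rw [map_add, mul_add _ (omega v₁)]
  have hab : (a * b : ZAB) = FreeAlgebra.basisFreeMonoid ℤ Letter
      (FreeMonoid.of Letter.a * FreeMonoid.of Letter.b) := by
    rw [basisFreeMonoid_mul, basisFreeMonoid_of, basisFreeMonoid_of]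
    rfl
  rw [hab, ← basisFreeMonoid_mul, ← basisFreeMonoid_mul, omega_word, omega_word, omega_word,
    ← omegaWord_append_ab]
  simp

theorem omega_b_mul (v : ZAB) : omega (b * v) = (b + y * a) * omega v := by
  refine eq_of_additive_of_word (f := fun v => omega (b * v))
    (g := fun v => (b + y * a) * omega v)
    (fun v₁ v₂ => ?_) (fun v₁ v₂ => ?_) (fun v => ?_) v
  · rw [mul_add, map_add]
  · rw [map_add, mul_add _ (omega v₁)]
  have hb : (b : ZAB) = FreeAlgebra.basisFreeMonoid ℤ Letter (FreeMonoid.of Letter.b) := by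
    rw [basisFreeMonoid_of]
    rfl
  rw [hb, ← basisFreeMonoid_mul, omega_word, omega_word]
  simp [omegaWord]

theorem omega_ab_mul (v : ZAB) :
    omega (a * b * v) = (1 + y) * (a * b + y * (b * a)) * omega v := by
  have h1 : omega 1 = 1 := by
    have := omega_word 1
    rwa [show FreeAlgebra.basisFreeMonoid ℤ Letter 1 = 1 by
      simp [FreeAlgebra.basisFreeMonoid, ← MonoidAlgebra.one_def], FreeMonoid.toList_one,
      omegaWord] at this
  have := omega_mul_ab_mul 1 v
  rwa [h1, one_mul, one_mul] at this

theorem commute_one_add_y (u : ZyAB) : Commute (1 + y) u :=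
  (Commute.one_left u).add_left (Algebra.commutes _ _)

end Omega

/-! ### Invariance under order embeddings -/

section Chains

variable {P Q : Type*} [PartialOrder P] [PartialOrder Q] [LocallyFiniteOrder P]
  [LocallyFiniteOrder Q]

theorem extAbIndex_map {r : RankFunction P} {r' : RankFunction Q} (φ : P ↪o Q)
    (hφ : (Set.range φ).OrdConnected) {s t : P} (hst : s ≤ t) :
    extAbIndex r s t = extAbIndex r' (φ s) (φ t) := by
  classical
  unfold extAbIndex
  rw [abIndex_map (r' := r') φ hst
    (fun z hz => ρ_eq_of_covBy_map φ (fun h => h.image φ hφ) hz)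
    (fun q h1 h2 => hφ.out ⟨s, rfl⟩ ⟨t, rfl⟩ ⟨h1.le, h2.le⟩)]
  exact if_congr φ.injective.eq_iff.symm rfl rfl

theorem modExtAbIndex_map {r : RankFunction P} {r' : RankFunction Q} (φ : P ↪o Q)
    (hφ : (Set.range φ).OrdConnected) {s t : P} (hst : s ≤ t) :
    modExtAbIndex r s t = modExtAbIndex r' (φ s) (φ t) := by
  classical
  unfold modExtAbIndex
  rw [abIndex_map (r' := r') φ hst
    (fun z hz => ρ_eq_of_covBy_map φ (fun h => h.image φ hφ) hz)
    (fun q h1 h2 => hφ.out ⟨s, rfl⟩ ⟨t, rfl⟩ ⟨h1.le, h2.le⟩)]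
  exact if_congr φ.injective.eq_iff.symm rfl rfl

end Chains

/-! ### Flats of restrictions and contractions -/

section Flats

variable {α : Type*} {M : Matroid α}

theorem isFlat_of_closure_subset {X : Set α} (hX : X ⊆ M.E) (h : M.closure X ⊆ X) :
    M.IsFlat X :=
  Matroid.isFlat_iff_closure_eq.2 (h.antisymm (M.subset_closure X hX))

theorem closure_subset_of_subset {X F : Set α} (hF : M.IsFlat F) (h : X ⊆ F) :
    M.closure X ⊆ F :=
  hF.closure ▸ M.closure_subset_closure h

theorem isFlat_restrict_iff {F G : Set α} (hF : M.IsFlat F) :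
    (M ↾ F).IsFlat G ↔ M.IsFlat G ∧ G ⊆ F := by
  constructor
  · intro h
    have hGF : G ⊆ F := h.subset_ground
    have hc := h.closure
    rw [M.restrict_closure_eq hGF hF.subset_ground,
      Set.inter_eq_self_of_subset_left (closure_subset_of_subset hF hGF)] at hc
    exact ⟨Matroid.isFlat_iff_closure_eq.2 hc, hGF⟩
  · rintro ⟨h, hGF⟩
    rw [Matroid.isFlat_iff_closure_eq, M.restrict_closure_eq hGF hF.subset_ground, h.closure,
      Set.inter_eq_self_of_subset_left hGF]

theorem isFlat_contract_iff {C G : Set α} (hC : C ⊆ M.E) :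
    (M ／ C).IsFlat G ↔ M.IsFlat (G ∪ C) ∧ Disjoint G C := by
  rw [Matroid.isFlat_iff_closure_eq, Matroid.isFlat_iff_closure_eq, M.contract_closure_eq]
  constructor
  · intro h
    have hd : Disjoint G C := h ▸ Set.disjoint_sdiff_left
    refine ⟨?_, hd⟩
    have hGE : G ⊆ M.E := h ▸ Set.sdiff_subset.trans (M.closure_subset_ground _)
    have hsub := M.subset_closure (G ∪ C) (Set.union_subset hGE hC)
    conv_rhs => rw [← h]
    rw [Set.sdiff_union_of_subset (Set.subset_union_right.trans hsub)]
  · rintro ⟨h, hd⟩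
    rw [h, Set.union_sdiff_right, hd.sdiff_eq_left]

/-- The flats of `M ↾ F` are the flats of `M` below `F`. -/
def restrictFlats {F : Set α} (hF : M.IsFlat F) : Flats (M ↾ F) ↪o Flats M where
  toFun G := ⟨G, ((isFlat_restrict_iff hF).1 G.2).1⟩
  inj' _ _ h := Subtype.ext (congrArg (fun H : Flats M => (H : Set α)) h)
  map_rel_iff' := Iff.rfl

/-- The flats of `M ／ C` are the flats of `M` containing `C`, with `C` removed. -/
def contractFlats {C : Set α} (hC : C ⊆ M.E) : Flats (M ／ C) ↪o Flats M :=
  OrderEmbedding.ofMapLEIff (fun G => ⟨G ∪ C, ((isFlat_contract_iff hC).1 G.2).1⟩) (by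
    intro G H
    constructor
    · intro h x hx
      have hGd := ((isFlat_contract_iff hC).1 G.2).2
      rcases h (Or.inl hx) with hx' | hx'
      · exact hx'
      · exact absurd hx' (Set.disjoint_left.1 hGd hx)
    · exact fun h => Set.union_subset_union_left C h)

theorem ordConnected_range_restrictFlats {F : Set α} (hF : M.IsFlat F) :
    (Set.range (restrictFlats hF)).OrdConnected := by
  refine Set.ordConnected_of_Ioo ?_
  rintro _ - _ ⟨H, rfl⟩ - K hK
  exact ⟨⟨K, (isFlat_restrict_iff hF).2 ⟨K.2, fun _ hx => H.2.subset_ground (hK.2.le hx)⟩⟩, rfl⟩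

theorem ordConnected_range_contractFlats {C : Set α} (hC : C ⊆ M.E) :
    (Set.range (contractFlats hC)).OrdConnected := by
  refine Set.ordConnected_of_Ioo ?_
  rintro _ ⟨G, rfl⟩ _ - - K hK
  have hCK : C ⊆ K := Set.subset_union_right.trans hK.1.le
  have hKC : (K : Set α) \ C ∪ C = K := Set.sdiff_union_of_subset hCK
  exact ⟨⟨K \ C, (isFlat_contract_iff hC).2 ⟨by rw [hKC]; exact K.2,
    Set.disjoint_sdiff_left⟩⟩, Subtype.ext hKC⟩

theorem restrictFlats_top (F : Flats M) : restrictFlats F.2 ⊤ = F := rfl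

theorem restrictFlats_bot (F : Flats M) : restrictFlats F.2 ⊥ = ⊥ := by
  refine Subtype.ext ?_
  change (M ↾ (F : Set α)).closure ∅ = M.closure ∅
  rw [M.restrict_closure_eq (Set.empty_subset _) F.2.subset_ground]
  exact Set.inter_eq_self_of_subset_left (closure_subset_of_subset F.2 (Set.empty_subset _))

theorem contractFlats_top {C : Set α} (hC : C ⊆ M.E) : contractFlats hC ⊤ = ⊤ :=
  Subtype.ext (Set.sdiff_union_of_subset hC)

theorem coe_contractFlats_bot {C : Set α} (hC : C ⊆ M.E) :
    (contractFlats hC ⊥ : Set α) = M.closure C := by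
  change (M ／ C).loops ∪ C = _
  rw [M.contract_loops_eq, Set.sdiff_union_of_subset (M.subset_closure C hC)]

variable [M.Finite]

theorem matroidExt_restrict (F : Flats M) :
    matroidExt (M ↾ (F : Set α)) = extAbIndex (flatRank M) ⊥ F := by
  rw [matroidExt, extAbIndex_map (r' := flatRank M) (restrictFlats F.2)
    (ordConnected_range_restrictFlats F.2) bot_le, restrictFlats_top, restrictFlats_bot]

theorem matroidModExt_restrict (F : Flats M) :
    matroidModExt (M ↾ (F : Set α)) = modExtAbIndex (flatRank M) ⊥ F := by
  rw [matroidModExt, modExtAbIndex_map (r' := flatRank M) (restrictFlats F.2)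
    (ordConnected_range_restrictFlats F.2) bot_le, restrictFlats_top, restrictFlats_bot]

theorem matroidModExt_contract {C : Set α} (hC : C ⊆ M.E) {X : Flats M}
    (hX : M.closure C = X) :
    matroidModExt (M ／ C) = modExtAbIndex (flatRank M) X ⊤ := by
  rw [matroidModExt, modExtAbIndex_map (r' := flatRank M) (contractFlats hC)
    (ordConnected_range_contractFlats hC) bot_le, contractFlats_top,
    show contractFlats hC ⊥ = X from Subtype.ext ((coe_contractFlats_bot hC).trans hX)]

end Flats

/-! ### Flats of a deletion -/

section Deletion

variable {α : Type*} {M : Matroid α} {i : α}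

theorem coe_eq_closure_diff (G : Flats (M ＼ {i})) : (G : Set α) = M.closure G \ {i} := by
  have h := G.2.closure
  have hd : Disjoint (G : Set α) {i} :=
    Set.disjoint_of_subset_left G.2.subset_ground Set.disjoint_sdiff_left
  rw [M.delete_closure_eq_of_disjoint hd] at h
  exact h.symm

/-- The flats of `M ＼ {i}`, embedded in the flats of `M` by taking closures. -/
def deleteFlats (M : Matroid α) (i : α) : Flats (M ＼ {i}) ↪o Flats M :=
  OrderEmbedding.ofMapLEIff (fun G => ⟨M.closure G, M.isFlat_closure _⟩) (by
    intro G H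
    constructor
    · intro h
      change (G : Set α) ⊆ H
      rw [coe_eq_closure_diff G, coe_eq_closure_diff H]
      exact Set.sdiff_subset_sdiff_left h
    · exact fun h => M.closure_subset_closure h)

theorem deleteFlats_bot (hi : M.IsNonloop i) : deleteFlats M i ⊥ = ⊥ := by
  refine Subtype.ext ?_
  change M.closure (M ＼ {i}).loops = M.loops
  rw [M.delete_loops_eq, Set.sdiff_singleton_eq_self hi.not_isLoop]
  exact M.closure_closure ∅

theorem deleteFlats_top (hi : ¬ M.IsColoop i) : deleteFlats M i ⊤ = ⊤ := by
  refine Subtype.ext ?_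
  by_contra h
  exact hi (Matroid.isColoop_iff_sdiff_closure.2 h)

variable [M.Finite]

theorem flatRank_deleteFlats (G H : Flats (M ＼ {i})) :
    (flatRank (M ＼ {i})).ρ G H = (flatRank M).ρ (deleteFlats M i G) (deleteFlats M i H) := by
  have h : ∀ K : Flats (M ＼ {i}), (M ＼ {i}).eRk K = M.eRk (deleteFlats M i K) := fun K => by
    change _ = M.eRk (M.closure K)
    rw [M.eRk_closure_eq]
    exact M.restrict_eRk_eq K.2.subset_ground
  change ENat.toNat _ - ENat.toNat _ = ENat.toNat _ - ENat.toNat _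
  rw [h, h]

/-- The flat spanned by `F` and `i`; for `F` in `flatsS M i` it is `F ∪ {i}`. -/
def addElement (i : α) (F : Flats M) : Flats M :=
  ⟨M.closure (insert i (F : Set α)), M.isFlat_closure _⟩

open Classical in
/-- The flats `F ∪ {i}` for `F` in `flatsS M i`. -/
noncomputable def flatsT (M : Matroid α) [M.Finite] (i : α) : Finset (Flats M) :=
  (flatsS M i).image (addElement i)

theorem mem_flatsS {F : Flats M} :
    F ∈ flatsS M i ↔ i ∉ (F : Set α) ∧ M.IsFlat (insert i (F : Set α)) := by
  simp [flatsS]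

theorem coe_addElement {F : Flats M} (hF : F ∈ flatsS M i) :
    (addElement i F : Set α) = insert i (F : Set α) :=
  (mem_flatsS.1 hF).2.closure

theorem mem_flatsT {X : Flats M} :
    X ∈ flatsT M i ↔ i ∈ (X : Set α) ∧ M.IsFlat ((X : Set α) \ {i}) := by
  classical
  rw [flatsT, Finset.mem_image]
  constructor
  · rintro ⟨F, hF, rfl⟩
    rw [coe_addElement hF]
    refine ⟨Set.mem_insert _ _, ?_⟩
    rw [Set.insert_sdiff_self_of_notMem (mem_flatsS.1 hF).1]
    exact F.2
  · rintro ⟨hi, hX⟩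
    have he : insert i ((X : Set α) \ {i}) = X := by
      rw [Set.insert_sdiff_singleton, Set.insert_eq_of_mem hi]
    have hF : (⟨_, hX⟩ : Flats M) ∈ flatsS M i :=
      mem_flatsS.2 ⟨fun h => h.2 rfl, by rw [he]; exact X.2⟩
    exact ⟨⟨_, hX⟩, hF, Subtype.ext ((coe_addElement hF).trans he)⟩

theorem lt_addElement {F : Flats M} (hF : F ∈ flatsS M i) : F < addElement i F := by
  refine lt_of_le_of_ne ?_ fun h => (mem_flatsS.1 hF).1 ?_
  · change (F : Set α) ⊆ addElement i F
    rw [coe_addElement hF]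
    exact Set.subset_insert _ _
  · rw [h, coe_addElement hF]
    exact Set.mem_insert _ _

theorem rank_addElement (hE : i ∈ M.E) {F : Flats M} (hF : F ∈ flatsS M i) :
    (flatRank M).ρ F (addElement i F) = 1 := by
  change (M.eRk (addElement i F)).toNat - (M.eRk F).toNat = 1
  rw [coe_addElement hF, rank_insert M F.2 hE (mem_flatsS.1 hF).1]
  omega

/-- Since `i` is not a coloop, no hyperplane is the complement of `i`. -/
theorem addElement_lt_top (hi : ¬ M.IsColoop i) {F : Flats M} (hF : F ∈ flatsS M i) :
    addElement i F < ⊤ := by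
  refine lt_top_iff_ne_top.2 fun h => hi ?_
  have hE : insert i (F : Set α) = M.E := by
    rw [← coe_addElement hF, h]
    rfl
  rw [Matroid.isColoop_iff_sdiff_closure]
  intro h'
  have hsub : M.E \ {i} ⊆ F := by
    rw [← hE]
    rintro x ⟨rfl | hx, hxi⟩
    exacts [absurd rfl hxi, hx]
  refine (mem_flatsS.1 hF).1 (closure_subset_of_subset F.2 hsub ?_)
  rw [h', ← hE]
  exact Set.mem_insert _ _

theorem flatsT_subset_Ioo (hi : ¬ M.IsColoop i) :
    flatsT M i ⊆ Finset.Ioo (⊥ : Flats M) ⊤ := by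
  classical
  intro X hX
  obtain ⟨F, hF, rfl⟩ := Finset.mem_image.1 hX
  exact Finset.mem_Ioo.2 ⟨bot_le.trans_lt (lt_addElement hF), addElement_lt_top hi hF⟩

open Classical in
/-- The flats of `M` properly below `F ∪ {i}` that are not of the form `G ∪ {i}` with `G` a flat are
those below `F`: if `X` is a flat below `F ∪ {i}` and `i ∈ X`, then the closure of `X \ {i}` lies in
`X ∩ F = X \ {i}`, so `X \ {i}` is a flat. -/
theorem Ioo_sdiff_flatsT_filter (hi : ¬ M.IsColoop i) {F : Flats M} (hF : F ∈ flatsS M i) :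
    (Finset.Ioo (⊥ : Flats M) ⊤ \ flatsT M i).filter (· < addElement i F)
      = Finset.Ioc ⊥ F := by
  ext X
  simp only [Finset.mem_filter, Finset.mem_sdiff, Finset.mem_Ioo, Finset.mem_Ioc, mem_flatsT]
  have hiF := (mem_flatsS.1 hF).1
  constructor
  · rintro ⟨⟨⟨hb, -⟩, hT⟩, hlt⟩
    refine ⟨hb, ?_⟩
    have hsub : (X : Set α) ⊆ insert i (F : Set α) := coe_addElement hF ▸ hlt.le
    have hXF : (X : Set α) \ {i} ⊆ F := by
      rintro x ⟨hx, hxi⟩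
      exact (hsub hx).resolve_left hxi
    by_cases hiX : i ∈ (X : Set α)
    · refine absurd ⟨hiX, isFlat_of_closure_subset
        (Set.sdiff_subset.trans X.2.subset_ground) fun x hx => ?_⟩ hT
      refine ⟨closure_subset_of_subset X.2 Set.sdiff_subset hx, ?_⟩
      rintro rfl
      exact hiF (closure_subset_of_subset F.2 hXF hx)
    · exact fun x hx => hXF ⟨hx, fun h => hiX (h ▸ hx)⟩
  · rintro ⟨hb, hle⟩
    have hlt := hle.trans_lt (lt_addElement hF)
    exact ⟨⟨⟨hb, hlt.trans (addElement_lt_top hi hF)⟩, fun h => hiF (hle h.1)⟩, hlt⟩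

open Classical in
/-- The closures of the flats of `M ＼ {i}` are the flats of `M` that are not of the form `F ∪ {i}` with
`F` a flat: a flat `X` containing `i` is spanned by `X \ {i}` unless `X \ {i}` is itself a flat. -/
theorem map_deleteFlats_Ioo (hn : M.IsNonloop i) (hi : ¬ M.IsColoop i) :
    (Finset.Ioo (⊥ : Flats (M ＼ {i})) ⊤).map (deleteFlats M i).toEmbedding
      = Finset.Ioo (⊥ : Flats M) ⊤ \ flatsT M i := by
  ext X
  simp only [Finset.mem_map, Finset.mem_sdiff, Finset.mem_Ioo, mem_flatsT,
    RelEmbedding.coe_toEmbedding]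
  constructor
  · rintro ⟨G, hG, rfl⟩
    refine ⟨?_, ?_⟩
    · rw [← deleteFlats_bot hn, ← deleteFlats_top hi]
      simpa using hG
    · rintro ⟨h1, h2⟩
      change M.IsFlat (M.closure G \ {i}) at h2
      rw [← coe_eq_closure_diff] at h2
      change i ∈ M.closure G at h1
      rw [h2.closure] at h1
      exact (G.2.subset_ground h1).2 rfl
  · rintro ⟨hX, hT⟩
    have hcl : M.closure ((X : Set α) \ {i}) = X := by
      by_cases hiX : i ∈ (X : Set α)
      · refine (closure_subset_of_subset X.2 Set.sdiff_subset).antisymm ?_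
        have hXE : (X : Set α) \ {i} ⊆ M.E := Set.sdiff_subset.trans X.2.subset_ground
        have hmem : i ∈ M.closure ((X : Set α) \ {i}) := by
          by_contra hcl
          refine hT ⟨hiX, isFlat_of_closure_subset hXE fun x hx => ?_⟩
          exact ⟨closure_subset_of_subset X.2 Set.sdiff_subset hx, fun h => hcl (h ▸ hx)⟩
        intro x hx
        by_cases hxi : x = i
        · exact hxi ▸ hmem
        · exact M.subset_closure _ hXE ⟨hx, hxi⟩
      · rw [Set.sdiff_singleton_eq_self hiX, X.2.closure]
    have hG : (M ＼ {i}).IsFlat ((X : Set α) \ {i}) := by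
      rw [Matroid.isFlat_iff_closure_eq,
        M.delete_closure_eq_of_disjoint Set.disjoint_sdiff_left, hcl]
    have he : deleteFlats M i ⟨_, hG⟩ = X := Subtype.ext hcl
    refine ⟨⟨_, hG⟩, ?_, he⟩
    rw [← he, ← deleteFlats_bot hn, ← deleteFlats_top hi] at hX
    simpa using hX

theorem addElement_injOn : Set.InjOn (addElement (M := M) i) (flatsS M i) := by
  intro F hF G hG h
  have h' : insert i (F : Set α) = insert i (G : Set α) := by
    rw [← coe_addElement hF, ← coe_addElement hG, h]
  refine Subtype.ext ?_
  rw [← Set.insert_sdiff_self_of_notMem (mem_flatsS.1 hF).1, h',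
    Set.insert_sdiff_self_of_notMem (mem_flatsS.1 hG).1]

/-- The deletion formula for the `ab`-index, with the restrictions and contractions of `M` expressed as
intervals in its lattice of flats. -/
theorem abIndex_deletion (hn : M.IsNonloop i) (hi : ¬ M.IsColoop i)
    (hflat : M.IsFlat (insert i M.loops)) :
    abIndex (flatRank M) ⊥ ⊤ = abIndex (flatRank (M ＼ {i})) ⊥ ⊤
      + b * abIndex (flatRank M) (addElement i ⊥) ⊤
      + ∑ F ∈ flatsS' M i,
          abIndex (flatRank M) ⊥ F * (a * b) * abIndex (flatRank M) (addElement i F) ⊤ := by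
  classical
  have hbot : (⊥ : Flats M) ∈ flatsS M i := mem_flatsS.2 ⟨hn.not_isLoop, hflat⟩
  have hdel : abIndex (flatRank (M ＼ {i})) ⊥ ⊤
      = chainSum (flatRank M) ⊥ ⊤ (Finset.Ioo ⊥ ⊤ \ flatsT M i) := by
    have hρ : ∀ G, (flatRank (M ＼ {i})).ρ ⊥ G = (flatRank M).ρ ⊥ (deleteFlats M i G) :=
      fun G => by rw [flatRank_deleteFlats, deleteFlats_bot hn]
    rw [abIndex_eq_chainSum, ← map_deleteFlats_Ioo hn hi]
    exact chainSum_map _ (by rw [hρ, deleteFlats_top hi]) fun G _ => hρ G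
  have hup : ∀ F ∈ flatsS M i, (Finset.Ioo (⊥ : Flats M) ⊤).filter (addElement i F < ·)
      = Finset.Ioo (addElement i F) ⊤ := by
    intro F hF
    ext X
    simp only [Finset.mem_filter, Finset.mem_Ioo]
    exact ⟨fun h => ⟨h.2, h.1.2⟩, fun h => ⟨⟨bot_le.trans_lt h.1, h.2⟩, h.1⟩⟩
  rw [abIndex_eq_chainSum, chainSum_eq_add_sum_first (fun c hc => Finset.mem_Ioo.1 hc)
    (flatsT_subset_Ioo hi), ← hdel, add_assoc]
  congr 1
  rw [flatsT, Finset.sum_image addElement_injOn, ← Finset.add_sum_erase _ _ hbot]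
  congr 1
  · rw [← flatsT, Ioo_sdiff_flatsT_filter hi hbot, Finset.Ioc_self,
      chainSum_empty (rank_addElement hn.mem_ground hbot), one_mul, hup ⊥ hbot,
      ← abIndex_eq_chainSum]
  · refine Finset.sum_congr rfl fun F hF => ?_
    obtain ⟨hne, hF⟩ := Finset.mem_erase.1 hF
    rw [← flatsT, Ioo_sdiff_flatsT_filter hi hF, hup F hF, ← abIndex_eq_chainSum,
      chainSum_Ioc (bot_lt_iff_ne_bot.2 hne) (lt_addElement hF)
        (rank_addElement hn.mem_ground hF), ← mul_assoc (abIndex _ _ _)]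

end Deletion

end ABIndex

/-! ### The extended identities -/

open ABIndex in
/-- `i` is a nonloop, not a coloop, and has no parallel elements: `0̂ ∪ {i}` is a flat, `0̂` being the set
of loops.  (For a loopless matroid this says that `{i}` is a flat.) -/
theorem mainTheorem8 {α : Type*} (M : Matroid α) [M.Finite] (i : α)
    (hnonloop : M.IsNonloop i) (hcoloop : ¬ M.IsColoop i)
    (hflat : M.IsFlat (insert i M.loops)) :
    (ABIndex.matroidExt M = ABIndex.matroidExt (M ＼ {i})
      + ∑ F ∈ ABIndex.flatsS M i,
          ABIndex.matroidExt (M ↾ (F : Set α))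
            * (ABIndex.a * ABIndex.b + ABIndex.y * (ABIndex.b * ABIndex.a))
            * ABIndex.matroidModExt (M ／ (insert i (F : Set α))))
    ∧
    (ABIndex.matroidModExt M = ABIndex.matroidModExt (M ＼ {i})
      + (ABIndex.b + ABIndex.y * ABIndex.a) * ABIndex.matroidModExt (M ／ {i})
      + ∑ F ∈ ABIndex.flatsS' M i,
          ABIndex.matroidModExt (M ↾ (F : Set α))
            * (ABIndex.a * ABIndex.b + ABIndex.y * (ABIndex.b * ABIndex.a))
            * ABIndex.matroidModExt (M ／ (insert i (F : Set α)))) := by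
  classical
  have hE := hnonloop.mem_ground
  have hbot : (⊥ : Flats M) ∈ flatsS M i := mem_flatsS.2 ⟨hnonloop.not_isLoop, hflat⟩
  have htop : (⊥ : Flats M) ≠ ⊤ := ((lt_addElement hbot).trans (addElement_lt_top hcoloop hbot)).ne
  have htop' : (⊥ : Flats (M ＼ {i})) ≠ ⊤ := fun h => htop <| by
    rw [← deleteFlats_bot hnonloop, ← deleteFlats_top hcoloop, h]
  have hup : ∀ F ∈ flatsS M i, matroidModExt (M ／ (insert i (F : Set α)))
      = (1 + y) * omega (abIndex (flatRank M) (addElement i F) ⊤) := fun F hF => by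
    rw [matroidModExt_contract (Set.insert_subset hE F.2.subset_ground)
      (X := addElement i F) rfl, modExtAbIndex,
      if_neg (addElement_lt_top hcoloop hF).ne]
  have hpt : matroidModExt (M ／ {i})
      = (1 + y) * omega (abIndex (flatRank M) (addElement i ⊥) ⊤) := by
    have hcl : M.closure {i} = addElement i (⊥ : Flats M) := by
      change _ = M.closure (insert i (M.closure ∅))
      rw [M.closure_insert_closure_eq_closure_insert, LawfulSingleton.insert_empty_eq]
    rw [matroidModExt_contract (Set.singleton_subset_iff.2 hE) hcl, modExtAbIndex,
      if_neg (addElement_lt_top hcoloop hbot).ne]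
  have hdel := abIndex_deletion hnonloop hcoloop hflat
  constructor
  · rw [matroidExt, matroidExt, extAbIndex, extAbIndex, if_neg htop, if_neg htop', hdel, mul_add,
      mul_add, map_add, map_add, add_assoc, Finset.mul_sum, map_sum,
      ← Finset.add_sum_erase _ _ hbot]
    congr 1
    congr 1
    -- For `F = ⊥` the extended index of `M ↾ F` is `1`, which is not an instance of `ω(a Ψ)`.
    · rw [hup _ hbot, matroidExt_restrict, extAbIndex, if_pos rfl, one_mul, ← mul_assoc,
        omega_ab_mul, (commute_one_add_y _).eq]
      simp only [mul_assoc]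
    · refine Finset.sum_congr rfl fun F hF => ?_
      obtain ⟨hne, hF⟩ := Finset.mem_erase.1 hF
      rw [hup F hF, matroidExt_restrict, extAbIndex, if_neg (Ne.symm hne), ← mul_assoc,
        ← mul_assoc a, omega_mul_ab_mul, (commute_one_add_y _).eq]
      simp only [mul_assoc]
  · rw [matroidModExt, matroidModExt, modExtAbIndex, modExtAbIndex, if_neg htop, if_neg htop',
      hdel, map_add, map_add, mul_add (1 + y), mul_add (1 + y), map_sum, Finset.mul_sum]
    congr 1
    · rw [hpt, omega_b_mul, ← mul_assoc, ← mul_assoc, (commute_one_add_y (b + y * a)).eq]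
    · refine Finset.sum_congr rfl fun F hF => ?_
      obtain ⟨hne, hF⟩ := Finset.mem_erase.1 hF
      rw [hup F hF, matroidModExt_restrict, modExtAbIndex, if_neg (Ne.symm hne),
        omega_mul_ab_mul, (commute_one_add_y (a * b + y * (b * a))).eq]
      simp only [mul_assoc]
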